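/- All graphs are finite and simple. A $\mathbb{Z}_q$-edge-weighted $K_f$ is a complete graph on $f$ vertices together with a function $\omega : E(K_f)\to\mathbb{Z}_q$; the weight of a path is the sum of the weights of its edges. For $t\ge 1$, a $t$-subdivision of a graph $H$ is a graph obtained by replacing each edge $uv$ of $H$ with a path of length exactly $t+1$ from $u$ to $v$ (a subdivision path), where the interior vertices of these paths are new and the paths are pairwise internally disjoint. A $t$-subdivision of $H$ contained as a subgraph in a $\mathbb{Z}_q$-edge-weighted $K_f$ is called $q$-divisible if each of its subdivision paths has weight $0$ in $\mathbb{Z}_q$. For $q\ge 2$ and $t\ge 1$ with $q\mid t+1$, let $$s_q(H,t)=\min\{f : \text{every } \mathbb{Z}_q\text{-edge-weighted } K_f \text{ contains a } q\text{-divisible } t\text{-subdivision of } H\}.$$ **Theorem.** (1) Let $T$ be a tree with $n$ vertices. Then $s_2(T,1)=2n-1$. (2) Let $C$ be a cycle with $n\ge 3$ vertices. Then $s_2(C,1)=2n$. -/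

import Mathlib

namespace DivisibleSubdivision

/-- A subdivision of the graph `H` contained in the graph `G`: an injective choice of branch
vertices, and for every edge `uv` of `H` a path of `G` joining the branch vertices of `u` and `v`
(the subdivision path of `uv`; traversed from `v` to `u` it is the reversed path). A subdivision
path contains no branch vertices other than its two ends, and the subdivision paths of different
edges meet only in branch vertices. -/
structure Subdivision {V W : Type*} (H : SimpleGraph V) (G : SimpleGraph W) where
  branch : V → W
  branch_injective : Function.Injective branch
  path : ∀ {u v : V}, H.Adj u v → G.Walk (branch u) (branch v)
  path_isPath : ∀ {u v : V} (h : H.Adj u v), (path h).IsPath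
  path_symm : ∀ {u v : V} (h : H.Adj u v), path h.symm = (path h).reverse
  eq_or_eq_of_branch_mem : ∀ {u v : V} (h : H.Adj u v) (w : V),
    branch w ∈ (path h).support → w = u ∨ w = v
  mem_range_branch_of_mem_of_mem : ∀ {u v u' v' : V} (h : H.Adj u v) (h' : H.Adj u' v'),
    s(u, v) ≠ s(u', v') → ∀ x : W,
    x ∈ (path h).support → x ∈ (path h').support → x ∈ Set.range branch

/-- The weight of a walk: the sum of the weights of its edges. -/
def walkWeight {W A : Type*} [AddCommMonoid A] {G : SimpleGraph W} (ω : Sym2 W → A) {x y : W}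
    (p : G.Walk x y) : A :=
  (p.edges.map ω).sum

/-- A subdivision is a `t`-subdivision if every subdivision path has length exactly `t + 1`,
that is, every edge is subdivided exactly `t` times. -/
def Subdivision.IsExact {V W : Type*} {H : SimpleGraph V} {G : SimpleGraph W}
    (S : Subdivision H G) (t : ℕ) : Prop :=
  ∀ {u v : V} (h : H.Adj u v), (S.path h).length = t + 1

/-- A subdivision is `q`-divisible for the edge weighting `ω` with values in `ZMod q` if every
subdivision path has weight zero in `ZMod q`. -/
def Subdivision.IsDivisible {V W : Type*} {H : SimpleGraph V} {G : SimpleGraph W} {q : ℕ}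
    (S : Subdivision H G) (ω : Sym2 W → ZMod q) : Prop :=
  ∀ {u v : V} (h : H.Adj u v), walkWeight ω (S.path h) = 0

/-- Every `ZMod q`-edge-weighted complete graph on `f` vertices contains a `q`-divisible
`t`-subdivision of `H`. (An edge weighting is given as a function on all unordered pairs; its
values on the diagonal pairs, which are not edges, are never used.) -/
def Forces {V : Type*} (q t : ℕ) (H : SimpleGraph V) (f : ℕ) : Prop :=
  ∀ ω : Sym2 (Fin f) → ZMod q,
    ∃ S : Subdivision H (⊤ : SimpleGraph (Fin f)), S.IsExact t ∧ S.IsDivisible ω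

/-- `s` is the `q`-divisible `t`-subdivision number `s_q(H, t)`: the minimum of all `f` such that
every `ZMod q`-edge-weighted complete graph on `f` vertices contains a `q`-divisible
`t`-subdivision of `H`. The existence of the minimum is part of the assertion. -/
def IsDivSubdivisionNumber {V : Type*} (q t : ℕ) (H : SimpleGraph V) (s : ℕ) : Prop :=
  IsLeast {f : ℕ | Forces q t H f} s

end DivisibleSubdivision

/-!
Give the pair `xy` the colour `c x y : Bool` that records whether `ω s(x, y) = 0`. A path of length
two has weight zero in `ZMod 2` exactly when its two edges have the same colour, so a divisible
`1`-subdivision of `H` consists of distinct *branch* vertices for the vertices of `H` and distinct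
*middle* vertices for the edges, each middle vertex seeing its two branch vertices in one colour.
The lower bounds only count vertices (`card_add_card_edgeSet_le_of_forces`): a `1`-subdivision of
`H` has `|V(H)| + |E(H)|` of them. For the upper bounds such a configuration is needed that fills
the host completely, and the argument depends on whether the colouring contains four vertices on
which one colour class (hence also the other) is a path (`IsAltPath`).

*No such four vertices.* By Seinsche's theorem on cographs (`exists_split_of_no_altPath`), every
set of at least two vertices splits into two nonempty parts with only one colour in between. Let `n`
be the number of vertices of `H`. Among the homogeneous sets (every outside vertex sees the set in a
single colour) with at least `n` vertices take a smallest one, `M`. If `|M| = n`, put all branch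
vertices into `M` and all middle vertices outside. Otherwise `M` splits into homogeneous parts `X`
and `Y`, both smaller than `n` by minimality. Fill `X` with branch vertices of a connected piece of
`H`, put the remaining branch vertices into `Y`, use the vertices of `Y` left over as middle
vertices of edges of the connected piece, and the vertices outside `M` as middle vertices of all
other edges. This works for every connected `H` (`exists_embedding_of_no_altPath`).

*Four such vertices exist, `H` a tree.* A tree with at least three vertices has two leaves with a
common neighbour, or a leaf whose neighbour has degree two. Delete these two vertices, embed the
rest by induction avoiding the four vertices, and use the four vertices for the deleted part: a
check of all colour patterns shows that they always fit (`IsAltPath.exists_leafPair`,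
`IsAltPath.exists_pendantPath`). See `exists_embedding_rooted_tree`.

*Four such vertices exist, `H` a cycle with `n` vertices.* Take a fifth vertex `e`, embed the path
with `n - 2` vertices into the remaining `2n - 5` vertices by the result on trees, and close the
cycle with the five vertices set aside. A check of the colour patterns (`exists_closing_order`)
shows that this is possible unless the colour pattern from `e` to the four vertices is one of five
*special* ones while that of one end of the path is not special. Choosing `e` non-special if there
is a non-special vertex at all excludes this case (`exists_embedding_cycle`).
-/

namespace DivisibleSubdivision

variable {V W ι : Type*}

/-! ### Embeddings of subdivided graphs into coloured complete graphs -/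

/-- A monochromatic-cherry embedding: the vertices in `U` and the edges in `E` of a graph, the edge
`e` joining `s e` and `t e`, are sent injectively to disjoint sets of vertices in `S` by `b`
(branch vertices) and `m` (middle vertices), such that the two pairs that join a middle vertex to
its branch vertices have the same colour under `c`. The values of `b` and `m` outside `U` and `E`
are irrelevant. -/
structure IsCherryEmbedding (c : W → W → Bool) (s t : ι → V) (U : Finset V) (E : Finset ι)
    (S : Finset W) (b : V → W) (m : ι → W) : Prop where
  branch_injOn : Set.InjOn b U
  mid_injOn : Set.InjOn m E
  branch_mem : ∀ v ∈ U, b v ∈ S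
  mid_mem : ∀ e ∈ E, m e ∈ S
  mid_ne_branch : ∀ e ∈ E, ∀ v ∈ U, m e ≠ b v
  mono : ∀ e ∈ E, c (m e) (b (s e)) = c (m e) (b (t e))

lemma IsCherryEmbedding.insert_branch [DecidableEq V] [DecidableEq W] {c : W → W → Bool}
    {s t : ι → V} {U : Finset V} {E : Finset ι} {S : Finset W} {b : V → W} {m : ι → W}
    (h : IsCherryEmbedding c s t U E S b m) (hE : ∀ e ∈ E, s e ∈ U ∧ t e ∈ U)
    {v : V} (hv : v ∉ U) {y : W} (hy : y ∉ S) :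
    IsCherryEmbedding c s t (insert v U) E (insert y S) (Function.update b v y) m := by
  have hb : ∀ u ∈ U, Function.update b v y u = b u := fun u hu =>
    Function.update_of_ne (by rintro rfl; exact hv hu) _ _
  obtain ⟨h1, h2, h3, h4, h5, h6⟩ := h
  refine ⟨?_, h2, ?_, fun e he => Finset.mem_insert_of_mem (h4 e he), ?_, fun e he => ?_⟩
  · rw [Finset.coe_insert, Set.injOn_insert (by simpa using hv)]
    refine ⟨fun p hp q hq => ?_, ?_⟩
    · rw [hb p hp, hb q hq]
      exact h1 hp hq
    · rintro ⟨u, hu, hu'⟩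
      rw [hb u hu, Function.update_self] at hu'
      exact hy (hu' ▸ h3 u hu)
  · intro u hu
    rcases Finset.mem_insert.1 hu with rfl | hu
    · simp
    · simp [hb u hu, h3 u hu]
  · intro e he u hu
    rcases Finset.mem_insert.1 hu with rfl | hu
    · rw [Function.update_self]
      exact fun h => hy (h ▸ h4 e he)
    · rw [hb u hu]
      exact h5 e he u hu
  · rw [hb _ (hE e he).1, hb _ (hE e he).2]
    exact h6 e he

lemma IsCherryEmbedding.insert_mid [DecidableEq ι] [DecidableEq W] {c : W → W → Bool}
    {s t : ι → V} {U : Finset V} {E : Finset ι} {S : Finset W} {b : V → W} {m : ι → W}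
    (h : IsCherryEmbedding c s t U E S b m) {e : ι} (he : e ∉ E) {x : W} (hx : x ∉ S)
    (hc : c x (b (s e)) = c x (b (t e))) :
    IsCherryEmbedding c s t U (insert e E) (insert x S) b (Function.update m e x) := by
  have hm : ∀ f ∈ E, Function.update m e x f = m f := fun f hf =>
    Function.update_of_ne (by rintro rfl; exact he hf) _ _
  obtain ⟨h1, h2, h3, h4, h5, h6⟩ := h
  refine ⟨h1, ?_, fun v hv => Finset.mem_insert_of_mem (h3 v hv), ?_, ?_, fun f hf => ?_⟩
  · rw [Finset.coe_insert, Set.injOn_insert (by simpa using he)]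
    refine ⟨fun p hp q hq => ?_, ?_⟩
    · rw [hm p hp, hm q hq]
      exact h2 hp hq
    · rintro ⟨f, hf, hf'⟩
      rw [hm f hf, Function.update_self] at hf'
      exact hx (hf' ▸ h4 f hf)
  · intro f hf
    rcases Finset.mem_insert.1 hf with rfl | hf
    · simp
    · simp [hm f hf, h4 f hf]
  · intro f hf u hu
    rcases Finset.mem_insert.1 hf with rfl | hf
    · rw [Function.update_self]
      exact fun h => hx (h ▸ h3 u hu)
    · rw [hm f hf]
      exact h5 f hf u hu
  · rcases Finset.mem_insert.1 hf with rfl | hf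
    · rw [Function.update_self]
      exact hc
    · rw [hm f hf]
      exact h6 f hf

/-- A new vertex `s e` that hangs on the old vertex `t e` by the new edge `e` can be sent to `y`,
with middle vertex `x`. -/
lemma IsCherryEmbedding.insert_leaf [DecidableEq V] [DecidableEq ι] [DecidableEq W]
    {c : W → W → Bool} {s t : ι → V} {U : Finset V} {E : Finset ι} {S : Finset W}
    {b : V → W} {m : ι → W} (h : IsCherryEmbedding c s t U E S b m)
    (hE : ∀ e ∈ E, s e ∈ U ∧ t e ∈ U) {e : ι} (hv : s e ∉ U) (he : e ∉ E) (ht : t e ∈ U)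
    {x y : W} (hx : x ∉ S) (hy : y ∉ S) (hxy : x ≠ y) (hc : c x (b (t e)) = c x y) :
    IsCherryEmbedding c s t (insert (s e) U) (insert e E) (insert x (insert y S))
      (Function.update b (s e) y) (Function.update m e x) := by
  refine (h.insert_branch hE hv hy).insert_mid he (by simp [hx, hxy]) ?_
  rw [Function.update_self, Function.update_of_ne (by rintro h; exact hv (h ▸ ht)), hc]

lemma IsCherryEmbedding.mono_target {c : W → W → Bool} {s t : ι → V}
    {U : Finset V} {E : Finset ι} {S S' : Finset W} {b : V → W} {m : ι → W}
    (h : IsCherryEmbedding c s t U E S b m) (hS : S ⊆ S') :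
    IsCherryEmbedding c s t U E S' b m :=
  ⟨h.branch_injOn, h.mid_injOn, fun v hv => hS (h.branch_mem v hv),
    fun e he => hS (h.mid_mem e he), h.mid_ne_branch, h.mono⟩

/-! ### Colourings without alternating paths -/

/-- The pairs of one colour among `w, x, y, z` are exactly the edges of the path `w x y z` (and so
those of the other colour are the edges of the path `y w z x`). For a symmetric `c` this forces the
four vertices to be distinct, see `IsAltPath.nodup`. -/
def IsAltPath (c : W → W → Bool) (w x y z : W) : Prop :=
  c x y = c w x ∧ c y z = c w x ∧ c w y = !c w x ∧ c w z = !c w x ∧ c x z = !c w x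

lemma IsAltPath.nodup {c : W → W → Bool} (hc : ∀ x y, c x y = c y x) {w x y z : W}
    (h : IsAltPath c w x y z) : [w, x, y, z].Nodup := by
  obtain ⟨h1, h2, h3, h4, h5⟩ := h
  have key : ∀ b : Bool, b ≠ !b := by decide
  simp only [List.nodup_cons, List.mem_cons, List.not_mem_nil, or_false, not_or,
    List.nodup_nil, and_true, not_false_eq_true]
  refine ⟨⟨?_, ?_, ?_⟩, ⟨?_, ?_⟩, ?_⟩ <;> rintro rfl
  · exact key _ (h1.symm.trans h3)
  · exact key _ (h2.symm.trans h4)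
  · exact key _ ((hc _ _).trans h5)
  · exact key _ h3
  · exact key _ h4
  · exact key _ (h1.symm.trans h5)

/-- Adding a vertex `v` to a set that splits into `X` and `Y` in colour `k`, when `v` has a
`k`-neighbour in `X`. If `v` sees `Y` entirely in colour `k`, then `Y` splits off; otherwise the
`k`-neighbours of `v` in `X` do. -/
lemma exists_split_insert_of_no_altPath [DecidableEq W] {c : W → W → Bool}
    (hc : ∀ x y, c x y = c y x) {X Y : Finset W} {v q : W} {k : Bool} (hvX : v ∉ X) (hvY : v ∉ Y)
    (hXY : Disjoint X Y) (hY : Y.Nonempty) (hk : ∀ x ∈ X, ∀ y ∈ Y, c x y = k)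
    (hP : ∀ w x y z, w ∈ insert v (X ∪ Y) → x ∈ insert v (X ∪ Y) → y ∈ insert v (X ∪ Y) →
      z ∈ insert v (X ∪ Y) → ¬ IsAltPath c w x y z)
    (hqX : q ∈ X) (hqk : c v q = k) :
    ∃ A ⊆ insert v (X ∪ Y), A.Nonempty ∧ (insert v (X ∪ Y) \ A).Nonempty ∧
      ∃ k, ∀ x ∈ A, ∀ y ∈ insert v (X ∪ Y) \ A, c x y = k := by
  have hdis : ∀ a ∈ X, a ∉ Y := fun a h1 h2 => Finset.disjoint_left.1 hXY h1 h2
  have hflip : ∀ b : Bool, b ≠ k → b = !k := fun b => by cases b <;> cases k <;> simp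
  by_cases hz : ∃ z ∈ Y, c v z ≠ k
  · obtain ⟨z, hz, hzk⟩ := hz
    refine ⟨X.filter (fun x => c v x = k), fun x hx => ?_, ⟨q, by simp [hqX, hqk]⟩,
      ⟨v, by simp [hvX]⟩, k, fun y hy x hx => ?_⟩
    · simp [(Finset.mem_filter.1 hx).1]
    · rw [Finset.mem_filter] at hy
      rw [Finset.mem_sdiff, Finset.mem_insert, Finset.mem_union, Finset.mem_filter] at hx
      rcases hx with ⟨rfl | hx | hx, hx'⟩
      · rw [hc]; exact hy.2
      · by_contra hne
        have hvx : c v x ≠ k := fun h => hx' ⟨hx, h⟩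
        refine hP v y z x (by simp) (by simp [hy.1]) (by simp [hz]) (by simp [hx]) ?_
        rw [IsAltPath, hy.2]
        exact ⟨hk y hy.1 z hz, (hc _ _).trans (hk x hx z hz), hflip _ hzk, hflip _ hvx,
          hflip _ hne⟩
      · exact hk y hy.1 x hx
  · push Not at hz
    refine ⟨Y, fun y hy => by simp [hy], hY, ⟨v, by simp [hvY]⟩, k, fun y hy x hx => ?_⟩
    rw [Finset.mem_sdiff, Finset.mem_insert, Finset.mem_union] at hx
    rcases hx with ⟨rfl | hx | hx, hx'⟩
    · rw [hc]; exact hz y hy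
    · rw [hc]; exact hk x hx y hy
    · exact absurd hx hx'

/-- Seinsche's theorem: a two-coloured complete graph without alternating paths is disconnected in
one of the colours. -/
lemma exists_split_of_no_altPath [DecidableEq W] {c : W → W → Bool} (hc : ∀ x y, c x y = c y x)
    (M : Finset W) (hM : 2 ≤ M.card)
    (hP : ∀ w ∈ M, ∀ x ∈ M, ∀ y ∈ M, ∀ z ∈ M, ¬ IsAltPath c w x y z) :
    ∃ X Y : Finset W, X.Nonempty ∧ Y.Nonempty ∧ Disjoint X Y ∧ X ∪ Y = M ∧
      ∃ k, ∀ x ∈ X, ∀ y ∈ Y, c x y = k := by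
  induction M using Finset.induction_on with
  | empty => simp at hM
  | insert v N hv ih =>
    rw [Finset.card_insert_of_notMem hv] at hM
    rcases Nat.lt_or_ge N.card 2 with h2 | h2
    · obtain ⟨u, rfl⟩ := Finset.card_eq_one.1 (by omega : N.card = 1)
      exact ⟨{v}, {u}, by simp, by simp, by simpa using hv, rfl, c v u, by simp⟩
    obtain ⟨X, Y, hX, hY, hXY, rfl, k, hk⟩ := ih h2 (fun w hw x hx y hy z hz =>
      hP w (Finset.mem_insert_of_mem hw) x (Finset.mem_insert_of_mem hx) y
        (Finset.mem_insert_of_mem hy) z (Finset.mem_insert_of_mem hz))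
    -- It suffices to find a nonempty proper part that sees the rest in a single colour.
    suffices H : ∃ A ⊆ insert v (X ∪ Y), A.Nonempty ∧ (insert v (X ∪ Y) \ A).Nonempty ∧
        ∃ k, ∀ x ∈ A, ∀ y ∈ insert v (X ∪ Y) \ A, c x y = k by
      obtain ⟨A, hA, h1, h2, k, h3⟩ := H
      exact ⟨A, _, h1, h2, Finset.disjoint_sdiff, Finset.union_sdiff_of_subset hA, k, h3⟩
    have hvX : v ∉ X := fun h => hv (Finset.mem_union_left _ h)
    have hvY : v ∉ Y := fun h => hv (Finset.mem_union_right _ h)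
    by_cases hall : ∀ x ∈ X ∪ Y, c v x = !k
    · refine ⟨{v}, by simp, by simp, ?_, !k, ?_⟩
      · obtain ⟨x, hx⟩ := hX
        exact ⟨x, by simp only [Finset.mem_sdiff, Finset.mem_insert, Finset.mem_union,
          Finset.mem_singleton]; exact ⟨Or.inr (Or.inl hx), by rintro rfl; exact hvX hx⟩⟩
      · intro x hx y hy
        rw [Finset.mem_singleton] at hx
        subst hx
        simp only [Finset.mem_sdiff, Finset.mem_insert, Finset.mem_singleton] at hy
        exact hall y (hy.1.resolve_left hy.2)
    push Not at hall
    obtain ⟨q, hq, hqk⟩ := hall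
    replace hqk : c v q = k := by revert hqk; cases c v q <;> cases k <;> simp
    have hP' := fun w x y z hw hx hy hz => hP w hw x hx y hy z hz
    rcases Finset.mem_union.1 hq with hq' | hq'
    · exact exists_split_insert_of_no_altPath hc hvX hvY hXY hY hk hP' hq' hqk
    · rw [Finset.union_comm] at hP' ⊢
      exact exists_split_insert_of_no_altPath hc hvY hvX hXY.symm hX
        (fun x hx y hy => (hc _ _).trans (hk y hy x hx)) hP' hq' hqk

/-! ### Embedding when there is no alternating path -/

lemma exists_mapsTo_injOn_of_card_le {α β : Type*} [Nonempty β] (A : Finset α) (B : Finset β)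
    (h : A.card ≤ B.card) : ∃ f : α → β, (∀ a ∈ A, f a ∈ B) ∧ Set.InjOn f A := by
  obtain ⟨f, hf, hfi⟩ := A.finite_toSet.exists_injOn_of_encard_le (t := (B : Set β))
    (by simpa [Set.encard_coe_eq_coe_finsetCard] using h)
  exact ⟨f, fun a ha => hf ha, hfi⟩

/-- `M ⊆ S` is homogeneous (a module) if every vertex of `S` outside `M` sees all of `M` in a single
colour. -/
def IsHomogeneous (c : W → W → Bool) (S M : Finset W) : Prop :=
  M ⊆ S ∧ ∀ y ∈ S, y ∉ M → ∀ x ∈ M, ∀ x' ∈ M, c y x = c y x'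

/-- The hypothesis `hseg` is the form in which connectedness of the graph is used: for every `k`
some `k` vertices span at least `k - 1` edges. -/
theorem exists_embedding_of_no_altPath [DecidableEq V] [DecidableEq W] [DecidableEq ι]
    {c : W → W → Bool} (hc : ∀ x y, c x y = c y x)
    {s t : ι → V} {U : Finset V} {E : Finset ι} (hU : U.Nonempty)
    (hE : ∀ e ∈ E, s e ∈ U ∧ t e ∈ U)
    (hseg : ∀ k, 1 ≤ k → k ≤ U.card → ∃ U' ⊆ U, U'.card = k ∧
      k ≤ (E.filter (fun e => s e ∈ U' ∧ t e ∈ U')).card + 1)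
    {S : Finset W} (hS : U.card + E.card ≤ S.card)
    (hP : ∀ w x y z, w ∈ S → x ∈ S → y ∈ S → z ∈ S → ¬ IsAltPath c w x y z) :
    ∃ b m, IsCherryEmbedding c s t U E S b m := by
  have hUpos := hU.card_pos
  obtain ⟨w₀, -⟩ : S.Nonempty := Finset.card_pos.1 (by omega)
  have : Nonempty W := ⟨w₀⟩
  obtain ⟨M, ⟨⟨hMS, hM⟩, hUM⟩, hmin⟩ : ∃ M, (IsHomogeneous c S M ∧ U.card ≤ M.card) ∧
      ∀ M', IsHomogeneous c S M' → U.card ≤ M'.card → M.card ≤ M'.card := by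
    have hex : ∃ n, ∃ M, (IsHomogeneous c S M ∧ U.card ≤ M.card) ∧ M.card = n :=
      ⟨_, S, ⟨⟨subset_rfl, fun y hy hy' => absurd hy hy'⟩, by omega⟩, rfl⟩
    classical
    obtain ⟨M, hM, hMn⟩ := Nat.find_spec hex
    exact ⟨M, hM, fun M' h1 h2 => hMn ▸ Nat.find_min' hex ⟨M', ⟨h1, h2⟩, rfl⟩⟩
  have hcardS : (S \ M).card + M.card = S.card := Finset.card_sdiff_add_card_eq_card hMS
  rcases hUM.eq_or_lt with hEq | hlt
  · obtain ⟨b, hb, hbi⟩ := exists_mapsTo_injOn_of_card_le U M hUM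
    obtain ⟨m, hm, hmi⟩ := exists_mapsTo_injOn_of_card_le E (S \ M) (by omega)
    refine ⟨b, m, hbi, hmi, fun v hv => hMS (hb v hv),
      fun e he => (Finset.mem_sdiff.1 (hm e he)).1, fun e he v hv h => ?_, fun e he => ?_⟩
    · exact (Finset.mem_sdiff.1 (hm e he)).2 (h ▸ hb v hv)
    · obtain ⟨h1, h2⟩ := Finset.mem_sdiff.1 (hm e he)
      exact hM _ h1 h2 _ (hb _ (hE e he).1) _ (hb _ (hE e he).2)
  obtain ⟨X, Y, hX, hY, hXY, rfl, k, hk⟩ := exists_split_of_no_altPath hc M (by omega)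
    (fun w hw x hx y hy z hz => hP w x y z (hMS hw) (hMS hx) (hMS hy) (hMS hz))
  have hXYcard : (X ∪ Y).card = X.card + Y.card := Finset.card_union_of_disjoint hXY
  have hdis : ∀ a ∈ X, a ∉ Y := fun a h1 h2 => Finset.disjoint_left.1 hXY h1 h2
  have hXn : X.card < U.card := by
    by_contra hge
    have := hmin X ⟨fun x hx => hMS (Finset.mem_union_left _ hx), fun y hy hyX x hx x' hx' => ?_⟩
      (by omega)
    · have := hY.card_pos
      omega
    · by_cases hyY : y ∈ Y
      · rw [hc, hk x hx y hyY, hc, hk x' hx' y hyY]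
      · exact hM y hy (by simp [hyX, hyY]) x (by simp [hx]) x' (by simp [hx'])
  have hYn : Y.card < U.card := by
    by_contra hge
    have := hmin Y ⟨fun x hx => hMS (Finset.mem_union_right _ hx), fun y hy hyX x hx x' hx' => ?_⟩
      (by omega)
    · have := hX.card_pos
      omega
    · by_cases hyY : y ∈ X
      · rw [hk y hyY x hx, hk y hyY x' hx']
      · exact hM y hy (by simp [hyX, hyY]) x (by simp [hx]) x' (by simp [hx'])
  -- The branch vertices of `U'` fill `X`, those of `U \ U'` occupy `Y₀ ⊆ Y`; the middle vertices of
  -- the edges in `E₀`, which lie inside `U'`, fill `Y \ Y₀`, and all others lie outside `X ∪ Y`.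
  obtain ⟨U', hU'U, hU'c, hU'E⟩ := hseg X.card hX.card_pos hXn.le
  have hUdiff : (U \ U').card + U'.card = U.card := Finset.card_sdiff_add_card_eq_card hU'U
  obtain ⟨E₀, hE₀, hE₀c⟩ := Finset.exists_subset_card_eq
    (by omega : X.card + Y.card - U.card ≤ (E.filter (fun e => s e ∈ U' ∧ t e ∈ U')).card)
  have hE₀E : E₀ ⊆ E := hE₀.trans (Finset.filter_subset _ _)
  have hEdiff : (E \ E₀).card + E₀.card = E.card := Finset.card_sdiff_add_card_eq_card hE₀E
  obtain ⟨b₁, hb₁, hb₁i⟩ := exists_mapsTo_injOn_of_card_le U' X hU'c.le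
  obtain ⟨Y₀, hY₀, hY₀c⟩ := Finset.exists_subset_card_eq (by omega : (U \ U').card ≤ Y.card)
  have hYdiff : (Y \ Y₀).card + Y₀.card = Y.card := Finset.card_sdiff_add_card_eq_card hY₀
  obtain ⟨b₂, hb₂, hb₂i⟩ := exists_mapsTo_injOn_of_card_le (U \ U') Y₀ hY₀c.ge
  obtain ⟨m₁, hm₁, hm₁i⟩ := exists_mapsTo_injOn_of_card_le E₀ (Y \ Y₀) (by omega)
  obtain ⟨m₂, hm₂, hm₂i⟩ := exists_mapsTo_injOn_of_card_le (E \ E₀) (S \ (X ∪ Y)) (by omega)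
  have hb : ∀ v ∈ U, (v ∈ U' ∧ b₁ v ∈ X) ∨ (v ∉ U' ∧ b₂ v ∈ Y₀) := fun v hv => by
    by_cases h : v ∈ U'
    · exact Or.inl ⟨h, hb₁ v h⟩
    · exact Or.inr ⟨h, hb₂ v (Finset.mem_sdiff.2 ⟨hv, h⟩)⟩
  have hm : ∀ e ∈ E, (e ∈ E₀ ∧ m₁ e ∈ Y ∧ m₁ e ∉ Y₀) ∨
      (e ∉ E₀ ∧ m₂ e ∈ S ∧ m₂ e ∉ X ∪ Y) := fun e he => by
    by_cases h : e ∈ E₀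
    · exact Or.inl ⟨h, Finset.mem_sdiff.1 (hm₁ e h)⟩
    · exact Or.inr ⟨h, Finset.mem_sdiff.1 (hm₂ e (Finset.mem_sdiff.2 ⟨he, h⟩))⟩
  let b : V → W := fun v => if v ∈ U' then b₁ v else b₂ v
  let m : ι → W := fun e => if e ∈ E₀ then m₁ e else m₂ e
  have hbM : ∀ v ∈ U, b v ∈ X ∪ Y := fun v hv => by
    rcases hb v hv with ⟨h1, h2⟩ | ⟨h1, h2⟩
    · simp [b, h1, h2]
    · simp [b, h1, hY₀ h2]
  refine ⟨b, m, ?_, ?_, fun v hv => hMS (hbM v hv), ?_, ?_, ?_⟩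
  · intro p hp q hq h
    rcases hb p hp with ⟨p1, p2⟩ | ⟨p1, p2⟩ <;> rcases hb q hq with ⟨q1, q2⟩ | ⟨q1, q2⟩ <;>
      simp only [b, p1, q1, if_true, if_false] at h
    · exact hb₁i p1 q1 h
    · exact absurd (hY₀ q2) (hdis _ (h ▸ p2))
    · exact absurd (hY₀ p2) (hdis _ (h ▸ q2))
    · exact hb₂i (by simpa using ⟨hp, p1⟩) (by simpa using ⟨hq, q1⟩) h
  · intro p hp q hq h
    rcases hm p hp with ⟨p1, p2, p3⟩ | ⟨p1, p2, p3⟩ <;>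
      rcases hm q hq with ⟨q1, q2, q3⟩ | ⟨q1, q2, q3⟩ <;>
      simp only [m, p1, q1, if_true, if_false] at h
    · exact hm₁i p1 q1 h
    · exact absurd (Finset.mem_union_right _ (h ▸ p2)) q3
    · exact absurd (Finset.mem_union_right _ (h ▸ q2)) p3
    · exact hm₂i (by simpa using ⟨hp, p1⟩) (by simpa using ⟨hq, q1⟩) h
  · intro e he
    rcases hm e he with ⟨h1, h2, h3⟩ | ⟨h1, h2, h3⟩
    · simp only [m, h1, if_true]
      exact hMS (Finset.mem_union_right _ h2)
    · simpa only [m, h1, if_false] using h2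
  · intro e he v hv h
    rcases hm e he with ⟨h1, h2, h3⟩ | ⟨h1, h2, h3⟩
    · rcases hb v hv with ⟨q1, q2⟩ | ⟨q1, q2⟩ <;>
        simp only [b, m, h1, q1, if_true, if_false] at h
      · exact hdis _ q2 (h ▸ h2)
      · exact h3 (h ▸ q2)
    · have := hbM v hv
      rw [← h] at this
      simp only [m, h1, if_false] at this
      exact h3 this
  · intro e he
    rcases hm e he with ⟨h1, h2, h3⟩ | ⟨h1, h2, h3⟩
    · obtain ⟨-, hs, ht⟩ := Finset.mem_filter.1 (hE₀ h1)
      simp only [m, b, h1, hs, ht, if_true]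
      rw [hc, hk _ (hb₁ _ hs) _ h2, hc, hk _ (hb₁ _ ht) _ h2]
    · have := hM (m₂ e) h2 h3 _ (hbM _ (hE e he).1) _ (hbM _ (hE e he).2)
      simpa only [m, h1, if_false] using this

/-! ### Colour patterns around an alternating path -/

/-- The colours on an alternating path with vertices `0, 1, 2, 3`; here and below `true` stands for
the colour of the edges of the path. Diagonal values are irrelevant. -/
def altPathColour : Fin 4 → Fin 4 → Bool :=
  ![![false, true, false, false], ![true, false, true, false], ![false, true, false, true],
    ![false, false, true, false]]

/-- The colours on an alternating path with vertices `1, 2, 3, 4` together with a further vertex `0`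
that sees the path in the pattern `x`. Diagonal values are irrelevant. -/
def attachedPathColour (x : Fin 4 → Bool) : Fin 5 → Fin 5 → Bool :=
  ![![false, x 0, x 1, x 2, x 3], ![x 0, false, true, false, false],
    ![x 1, true, false, true, false], ![x 2, false, true, false, true],
    ![x 3, false, false, true, false]]

/-- The five special patterns in which a vertex can see an alternating path: the vertex closes the
path to a five-cycle, or it repeats one of the vertices of the path (as a true twin of an inner
vertex, or as a false twin of an end). -/
def IsSpecialType (x0 x1 x2 x3 : Bool) : Bool :=
  (x0 && !x1 && !x2 && x3) || (x1 && x2 && (x0 != x3)) || (!x0 && !x3 && (x1 != x2))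

set_option maxRecDepth 100000 in
/-- The combinatorial core of the result on cycles. The five vertices `0, …, 4` can be ordered as
`i, j, k, l, o` so that between two vertices with colour patterns `u` and `v` the vertices `i`, `k`
and `o` are middle vertices and `j` and `l` are branch vertices, unless the pattern `x` is special
and the pattern `u` on the path is not. -/
lemma exists_closing_order : ∀ x0 x1 x2 x3 u0 u1 u2 u3 u4 v0 v1 v2 v3 v4 : Bool,
    (IsSpecialType x0 x1 x2 x3 → IsSpecialType u1 u2 u3 u4) →
    ∃ i j : Fin 5, i ≠ j ∧
      ![u0, u1, u2, u3, u4] i = attachedPathColour ![x0, x1, x2, x3] i j ∧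
      ∃ k l : Fin 5, [i, j, k, l].Nodup ∧
      attachedPathColour ![x0, x1, x2, x3] j k = attachedPathColour ![x0, x1, x2, x3] k l ∧
      ∃ o : Fin 5, [i, j, k, l, o].Nodup ∧
        attachedPathColour ![x0, x1, x2, x3] l o = ![v0, v1, v2, v3, v4] o := by
  decide +kernel

lemma exists_leafPair_order : ∀ u0 u1 u2 u3 : Bool, ∃ i j k l : Fin 4, [i, j, k, l].Nodup ∧
    ![u0, u1, u2, u3] i = altPathColour i j ∧ ![u0, u1, u2, u3] k = altPathColour k l := by
  decide +kernel

lemma exists_pendantPath_order : ∀ u0 u1 u2 u3 : Bool, ∃ i j k l : Fin 4, [i, j, k, l].Nodup ∧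
    ![u0, u1, u2, u3] i = altPathColour i j ∧ altPathColour j k = altPathColour k l := by
  decide +kernel

lemma IsAltPath.colour_eq {c : W → W → Bool} (hc : ∀ x y, c x y = c y x) {w x y z : W}
    (h : IsAltPath c w x y z) (i j : Fin 4) (hij : i ≠ j) :
    c (![w, x, y, z] i) (![w, x, y, z] j) = (c w x == altPathColour i j) := by
  obtain ⟨h1, h2, h3, h4, h5⟩ := h
  have h0' := hc x w
  have h1' := hc y x
  have h2' := hc z y
  have h3' := hc y w
  have h4' := hc z w
  have h5' := hc z x
  fin_cases i <;> fin_cases j <;> first | exact absurd rfl hij | simp_all [altPathColour]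

lemma IsAltPath.injective {c : W → W → Bool} (hc : ∀ x y, c x y = c y x) {w x y z : W}
    (h : IsAltPath c w x y z) : Function.Injective ![w, x, y, z] := by
  have := h.nodup hc
  rw [← List.nodup_ofFn]
  simpa [List.ofFn_succ] using this

/-- Two leaves at a vertex sent to `v` can be accommodated in an alternating path. -/
lemma IsAltPath.exists_leafPair {c : W → W → Bool} (hc : ∀ x y, c x y = c y x) {w x y z : W}
    (h : IsAltPath c w x y z) (v : W) : ∃ x₁ y₁ x₂ y₂ : W, [x₁, y₁, x₂, y₂].Nodup ∧
      [x₁, y₁, x₂, y₂] ⊆ [w, x, y, z] ∧ c x₁ v = c x₁ y₁ ∧ c x₂ v = c x₂ y₂ := by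
  have hP : ∀ i, ![w, x, y, z] i ∈ [w, x, y, z] := by intro i; fin_cases i <;> simp
  have hv : ∀ i, c (![w, x, y, z] i) v =
      (c w x == ![c w x == c w v, c w x == c x v, c w x == c y v, c w x == c z v] i) := by
    intro i; fin_cases i <;> simp
  obtain ⟨i, j, l, o, hd, h1, h2⟩ :=
    exists_leafPair_order (c w x == c w v) (c w x == c x v) (c w x == c y v) (c w x == c z v)
  refine ⟨_, _, _, _, hd.map (h.injective hc), ?_, ?_, ?_⟩
  · simp only [List.cons_subset, hP, List.nil_subset, and_self]
  · rw [hv, h1, h.colour_eq hc _ _ (by simp at hd; tauto)]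
  · rw [hv, h2, h.colour_eq hc _ _ (by simp at hd; tauto)]

/-- A path with two edges hanging on a vertex sent to `v` can be accommodated in an alternating
path. -/
lemma IsAltPath.exists_pendantPath {c : W → W → Bool} (hc : ∀ x y, c x y = c y x) {w x y z : W}
    (h : IsAltPath c w x y z) (v : W) : ∃ x₁ y₁ x₂ y₂ : W, [x₁, y₁, x₂, y₂].Nodup ∧
      [x₁, y₁, x₂, y₂] ⊆ [w, x, y, z] ∧ c x₁ v = c x₁ y₁ ∧ c x₂ y₁ = c x₂ y₂ := by
  have hP : ∀ i, ![w, x, y, z] i ∈ [w, x, y, z] := by intro i; fin_cases i <;> simp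
  have hv : ∀ i, c (![w, x, y, z] i) v =
      (c w x == ![c w x == c w v, c w x == c x v, c w x == c y v, c w x == c z v] i) := by
    intro i; fin_cases i <;> simp
  obtain ⟨i, j, l, o, hd, h1, h2⟩ :=
    exists_pendantPath_order (c w x == c w v) (c w x == c x v) (c w x == c y v) (c w x == c z v)
  refine ⟨_, _, _, _, hd.map (h.injective hc), ?_, ?_, ?_⟩
  · simp only [List.cons_subset, hP, List.nil_subset, and_self]
  · rw [hv, h1, h.colour_eq hc _ _ (by simp at hd; tauto)]
  · rw [hc, h.colour_eq hc _ _ (by simp at hd; tauto), h2,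
      h.colour_eq hc _ _ (by simp at hd; tauto)]

/-- The vertex `v` sees the alternating path `w x y z` in a special pattern. -/
def IsSpecialVertex (c : W → W → Bool) (w x y z v : W) : Prop :=
  IsSpecialType (c w x == c w v) (c w x == c x v) (c w x == c y v) (c w x == c z v) = true

/-- A path whose ends are sent to `u` and `v` can be closed to a cycle with two more vertices by
means of an alternating path and a further vertex `e`. -/
lemma IsAltPath.exists_closing {c : W → W → Bool} (hc : ∀ x y, c x y = c y x) {w x y z : W}
    (h : IsAltPath c w x y z) {e u v : W} (he : e ∉ [w, x, y, z])
    (hspec : IsSpecialVertex c w x y z e → IsSpecialVertex c w x y z u) :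
    ∃ x₁ y₁ x₂ y₂ x₃ : W, [x₁, y₁, x₂, y₂, x₃].Nodup ∧
      [x₁, y₁, x₂, y₂, x₃] ⊆ [e, w, x, y, z] ∧
      c x₁ u = c x₁ y₁ ∧ c x₂ y₁ = c x₂ y₂ ∧ c x₃ y₂ = c x₃ v := by
  have hP : ∀ i, ![e, w, x, y, z] i ∈ [e, w, x, y, z] := by intro i; fin_cases i <;> simp
  have hinj : Function.Injective ![e, w, x, y, z] := by
    have := List.nodup_cons.2 ⟨he, h.nodup hc⟩
    rw [← List.nodup_ofFn]
    simpa [List.ofFn_succ] using this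
  have hv : ∀ v i, c (![e, w, x, y, z] i) v = (c w x == ![c w x == c e v, c w x == c w v,
      c w x == c x v, c w x == c y v, c w x == c z v] i) := by
    intro v i; fin_cases i <;> simp
  have hcol : ∀ i j, i ≠ j → c (![e, w, x, y, z] i) (![e, w, x, y, z] j) =
      (c w x == attachedPathColour ![c w x == c w e, c w x == c x e, c w x == c y e,
        c w x == c z e] i j) := by
    obtain ⟨h1, h2, h3, h4, h5⟩ := h
    intro i j hij
    have h0' := hc x w
    have h1' := hc y x
    have h2' := hc z y
    have h3' := hc y w
    have h4' := hc z w
    have h5' := hc z x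
    have g1 := hc w e
    have g2 := hc x e
    have g3 := hc y e
    have g4 := hc z e
    fin_cases i <;> fin_cases j <;>
      first | exact absurd rfl hij | simp_all [attachedPathColour]
  obtain ⟨i, j, hij, h1, l, o, hd, h2, q, hd', h3⟩ := exists_closing_order _ _ _ _
    (c w x == c e u) _ _ _ _ (c w x == c e v) (c w x == c w v) (c w x == c x v)
    (c w x == c y v) (c w x == c z v) hspec
  refine ⟨_, _, _, _, _, hd'.map hinj, ?_, ?_, ?_, ?_⟩
  · simp only [List.cons_subset, hP, List.nil_subset, and_self]
  · rw [hv, h1, hcol _ _ hij]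
  · rw [hc, hcol _ _ (by simp at hd'; tauto), h2, hcol _ _ (by simp at hd'; tauto)]
  · rw [hc, hcol _ _ (by simp at hd'; tauto), h3, hv]

/-! ### Trees -/

/-- A rooted tree has subtrees containing the root of every possible size. Here and below, trees are
given by a root `r`, a parent function and the depth function `d`. -/
lemma exists_closed_subset [DecidableEq V] {r : V} {par : V → V} {d : V → ℕ} (hr : d r = 0)
    (hd : ∀ v, v ≠ r → d v = d (par v) + 1) {U : Finset V} (hrU : r ∈ U)
    (hU : ∀ v ∈ U, v ≠ r → par v ∈ U) {k : ℕ} (hk : 1 ≤ k) (hkU : k ≤ U.card) :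
    ∃ U' ⊆ U, U'.card = k ∧ r ∈ U' ∧ ∀ v ∈ U', v ≠ r → par v ∈ U' := by
  induction hn : U.card - k generalizing U with
  | zero => exact ⟨U, subset_rfl, by omega, hrU, hU⟩
  | succ n ih =>
    obtain ⟨v, hv, hmax⟩ := U.exists_max_image d ⟨r, hrU⟩
    have hvr : v ≠ r := by
      rintro rfl
      obtain ⟨u, hu, huv⟩ := Finset.exists_mem_ne (by omega : 1 < U.card) v
      have := hd u huv
      have := hmax u hu
      omega
    have hcard := Finset.card_erase_of_mem hv
    obtain ⟨U', h1, h2⟩ := ih (U := U.erase v) (Finset.mem_erase.2 ⟨hvr.symm, hrU⟩)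
      (fun u hu hur => Finset.mem_erase.2 ⟨fun h => by
        have := hd u hur
        have := hmax u (Finset.mem_of_mem_erase hu)
        rw [h] at *
        omega, hU u (Finset.mem_of_mem_erase hu) hur⟩) (by omega) (by omega)
    exact ⟨U', h1.trans (Finset.erase_subset _ _), h2⟩

lemma exists_embedding_edge [DecidableEq V] [DecidableEq W] {c : W → W → Bool}
    (hc : ∀ x y, c x y = c y x) {par : V → V} {r v : V} (hvr : v ≠ r) (hv : par v = r)
    {w x y z : W} (h : IsAltPath c w x y z) {S : Finset W} (hS : ∀ a ∈ [w, x, y, z], a ∈ S) :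
    ∃ b m, IsCherryEmbedding c id par {v, r} {v} S b m := by
  have hnd := h.nodup hc
  simp only [List.nodup_cons, List.mem_cons, List.not_mem_nil, or_false, not_or] at hnd
  have h0 : IsCherryEmbedding c id par {r} ∅ {w} (fun _ => w) (fun _ => w) := by
    constructor <;> simp
  refine ⟨_, _, (h0.insert_leaf (e := v) (x := x) (y := y) (by simp) (by simpa using hvr) (by simp)
    (by simp [hv]) ?_ ?_ ?_ ?_).mono_target ?_⟩
  · simpa using fun h => hnd.1.1 h.symm
  · simpa using fun h => hnd.1.2.1 h.symm
  · exact hnd.2.1.1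
  · rw [hc, h.1]
  · intro a ha
    apply hS
    simp only [Finset.mem_insert, Finset.mem_singleton] at ha
    rcases ha with rfl | rfl | rfl <;> simp

/-- Two deleted vertices of a tree, either siblings or parent and child, are put back by means of an
alternating path. -/
lemma exists_embedding_insert_two [DecidableEq V] [DecidableEq W] {c : W → W → Bool}
    (hc : ∀ x y, c x y = c y x) {par : V → V} {w x y z : W} (hpath : IsAltPath c w x y z)
    {U E : Finset V} {S : Finset W} (hout : ∀ a ∈ [w, x, y, z], a ∉ S) {b m : V → W}
    (hbm : IsCherryEmbedding c id par U E S b m) (hE : ∀ e ∈ E, id e ∈ U ∧ par e ∈ U)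
    {v₁ v₂ : V} (hv₁ : v₁ ∉ U) (hv₂ : v₂ ∉ U) (hne : v₁ ≠ v₂) (hp₁ : par v₁ ∈ U)
    (hp₂ : par v₂ = par v₁ ∨ par v₂ = v₁) :
    ∃ b m, IsCherryEmbedding c id par (insert v₂ (insert v₁ U)) (insert v₂ (insert v₁ E))
      ([w, x, y, z].toFinset ∪ S) b m := by
  obtain ⟨x₁, y₁, x₂, y₂, hnd, hsub, hc₁, hc₂⟩ : ∃ x₁ y₁ x₂ y₂ : W,
      [x₁, y₁, x₂, y₂].Nodup ∧ [x₁, y₁, x₂, y₂] ⊆ [w, x, y, z] ∧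
      c x₁ (b (par v₁)) = c x₁ y₁ ∧ c x₂ (Function.update b v₁ y₁ (par v₂)) = c x₂ y₂ := by
    rcases hp₂ with hp₂ | hp₂
    · obtain ⟨x₁, y₁, x₂, y₂, h1, h2, h3, h4⟩ := hpath.exists_leafPair hc (b (par v₁))
      refine ⟨x₁, y₁, x₂, y₂, h1, h2, h3, ?_⟩
      rw [hp₂, Function.update_of_ne (ne_of_mem_of_not_mem hp₁ hv₁), h4]
    · obtain ⟨x₁, y₁, x₂, y₂, h1, h2, h3, h4⟩ := hpath.exists_pendantPath hc (b (par v₁))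
      exact ⟨x₁, y₁, x₂, y₂, h1, h2, h3, by rw [hp₂, Function.update_self, h4]⟩
  simp only [List.cons_subset, List.nil_subset, and_true] at hsub
  obtain ⟨hx₁, hy₁, hx₂, hy₂⟩ := hsub
  simp only [List.nodup_cons, List.mem_cons, List.not_mem_nil, or_false, not_or] at hnd
  have h1 := hbm.insert_leaf (e := v₁) hE hv₁ (fun h => hv₁ (hE _ h).1) hp₁
    (hout _ hx₁) (hout _ hy₁) hnd.1.1 hc₁
  have hpv₂ : par v₂ ∈ insert v₁ U := by
    rcases hp₂ with hp₂ | hp₂ <;> simp [hp₂, hp₁]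
  have hv₂' : v₂ ∉ insert v₁ U := by simp [hne.symm, hv₂]
  have hv₂E : v₂ ∉ insert v₁ E := by
    rw [Finset.mem_insert, not_or]
    exact ⟨hne.symm, fun h => hv₂ (hE _ h).1⟩
  have h2 := h1.insert_leaf (e := v₂) (x := x₂) (y := y₂) ?_ hv₂' hv₂E hpv₂ ?_ ?_ hnd.2.2.1 hc₂
  · refine ⟨_, _, h2.mono_target fun a ha => ?_⟩
    rw [Finset.mem_union, List.mem_toFinset]
    simp only [Finset.mem_insert] at ha
    rcases ha with rfl | rfl | rfl | rfl | ha
    · exact Or.inl hx₂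
    · exact Or.inl hy₂
    · exact Or.inl hx₁
    · exact Or.inl hy₁
    · exact Or.inr ha
  · intro e he
    rcases Finset.mem_insert.1 he with rfl | he
    · exact ⟨Finset.mem_insert_self _ _, Finset.mem_insert_of_mem hp₁⟩
    · exact ⟨Finset.mem_insert_of_mem (hE e he).1, Finset.mem_insert_of_mem (hE e he).2⟩
  · simp only [Finset.mem_insert, not_or]
    exact ⟨fun h => hnd.1.2.1 h.symm, fun h => hnd.2.1.1 h.symm, hout _ hx₂⟩
  · simp only [Finset.mem_insert, not_or]
    exact ⟨fun h => hnd.1.2.2 h.symm, fun h => hnd.2.1.2 h.symm, hout _ hy₂⟩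

theorem exists_embedding_rooted_tree [DecidableEq V] [DecidableEq W] {c : W → W → Bool}
    (hc : ∀ x y, c x y = c y x) {r : V} {par : V → V} {d : V → ℕ} (hr : d r = 0)
    (hd : ∀ v, v ≠ r → d v = d (par v) + 1) (U : Finset V) (hrU : r ∈ U)
    (hU : ∀ v ∈ U, v ≠ r → par v ∈ U) (S : Finset W) (hS : 2 * U.card ≤ S.card + 1) :
    ∃ b m, IsCherryEmbedding c id par U (U.erase r) S b m := by
  have hd0 : ∀ v, d v = 0 → v = r := fun v hv => by
    by_contra h
    have := hd v h
    omega
  induction hn : U.card using Nat.strong_induction_on generalizing U S with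
  | _ n ih =>
  have hUcard := Finset.card_erase_of_mem hrU
  have hUpos : 0 < U.card := Finset.card_pos.2 ⟨r, hrU⟩
  by_cases hP : ∀ w x y z, w ∈ S → x ∈ S → y ∈ S → z ∈ S → ¬ IsAltPath c w x y z
  · refine exists_embedding_of_no_altPath hc ⟨r, hrU⟩ ?_ ?_ (by omega) hP
    · intro e he
      rw [Finset.mem_erase] at he
      exact ⟨he.2, hU e he.2 he.1⟩
    · intro k hk hkU
      obtain ⟨U', h1, h2, h3, h4⟩ := exists_closed_subset hr hd hrU hU hk hkU
      refine ⟨U', h1, h2, ?_⟩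
      have : U'.erase r ⊆ (U.erase r).filter (fun e => id e ∈ U' ∧ par e ∈ U') := by
        intro e he
        rw [Finset.mem_erase] at he
        simp only [Finset.mem_filter, Finset.mem_erase, id]
        exact ⟨⟨he.1, h1 he.2⟩, he.2, h4 e he.2 he.1⟩
      have := Finset.card_le_card this
      rw [Finset.card_erase_of_mem h3] at this
      omega
  push Not at hP
  obtain ⟨w, x, y, z, hw, hx, hy, hz, hpath⟩ := hP
  have hPS : ∀ a ∈ [w, x, y, z], a ∈ S := by simp [hw, hx, hy, hz]
  obtain ⟨v, hvU, hmax⟩ := U.exists_max_image d ⟨r, hrU⟩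
  by_cases hvr : v = r
  · have hUr : U = {r} := by
      refine Finset.eq_singleton_iff_unique_mem.2 ⟨hrU, fun u hu => hd0 u ?_⟩
      have := hmax u hu
      rw [hvr, hr] at this
      omega
    refine ⟨fun _ => w, fun _ => w, ?_⟩
    subst hUr
    constructor <;> simp [hw]
  -- Two childless vertices, or a childless vertex with its parent, are deleted; the four vertices
  -- of the alternating path are set aside for them.
  have key : ∀ v₁ v₂ : V, v₁ ∈ U → v₂ ∈ U → v₁ ≠ v₂ → v₁ ≠ r → v₂ ≠ r →
      (∀ u ∈ (U.erase v₁).erase v₂, u ≠ r → par u ≠ v₁ ∧ par u ≠ v₂) → par v₁ ≠ v₁ →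
      par v₁ ≠ v₂ → (par v₂ = par v₁ ∨ par v₂ = v₁) →
      ∃ b m, IsCherryEmbedding c id par U (U.erase r) S b m := by
    intro v₁ v₂ hv₁ hv₂ hne hr₁ hr₂ hchild hp₁ hp₁' hp₂
    set U' := (U.erase v₁).erase v₂ with hU'
    have hU'c : U'.card + 2 = U.card := by
      have h1 := Finset.card_erase_of_mem hv₁
      have h2 := Finset.card_erase_of_mem (Finset.mem_erase.2 ⟨hne.symm, hv₂⟩)
      have : 1 < U.card := Finset.one_lt_card.2 ⟨v₁, hv₁, v₂, hv₂, hne⟩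
      rw [← hU'] at h2
      omega
    have hmem : ∀ u, u ∈ U' ↔ u ≠ v₂ ∧ u ≠ v₁ ∧ u ∈ U := fun u => by
      simp [hU', Finset.mem_erase]
    set S' := S \ [w, x, y, z].toFinset with hS'
    have hS'c : S.card ≤ S'.card + 4 := by
      have := Finset.le_card_sdiff [w, x, y, z].toFinset S
      have h4 := List.toFinset_card_le [w, x, y, z]
      simp only [List.length_cons, List.length_nil] at h4
      rw [← hS'] at this
      omega
    have hout : ∀ a ∈ [w, x, y, z], a ∉ S' := fun a ha h =>
      (Finset.mem_sdiff.1 h).2 (List.mem_toFinset.2 ha)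
    obtain ⟨b, m, hbm⟩ := ih U'.card (by omega) U' ((hmem r).2 ⟨hr₂.symm, hr₁.symm, hrU⟩)
      (fun u hu hur => (hmem _).2 ⟨(hchild u hu hur).2, (hchild u hu hur).1,
        hU u ((hmem u).1 hu).2.2 hur⟩) S' (by omega) rfl
    have hq : par v₁ ∈ U' := (hmem _).2 ⟨hp₁', hp₁, hU v₁ hv₁ hr₁⟩
    have hE' : ∀ e ∈ U'.erase r, id e ∈ U' ∧ par e ∈ U' := fun e he => by
      rw [Finset.mem_erase] at he
      exact ⟨he.2, (hmem _).2 ⟨(hchild e he.2 he.1).2, (hchild e he.2 he.1).1,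
        hU e ((hmem e).1 he.2).2.2 he.1⟩⟩
    obtain ⟨b', m', h⟩ := exists_embedding_insert_two hc hpath hout hbm hE' (v₁ := v₁) (v₂ := v₂)
      (by simp [hmem]) (by simp [hmem]) hne hq hp₂
    have hUe : insert v₂ (insert v₁ U') = U := by
      rw [hU', Finset.erase_right_comm, Finset.insert_erase (Finset.mem_erase.2 ⟨hne, hv₁⟩),
        Finset.insert_erase hv₂]
    have hEe : insert v₂ (insert v₁ (U'.erase r)) = U.erase r := by
      rw [← hUe, Finset.erase_insert_of_ne hr₂, Finset.erase_insert_of_ne hr₁]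
    have hSe : [w, x, y, z].toFinset ∪ S' ⊆ S :=
      Finset.union_subset (fun a ha => hPS a (List.mem_toFinset.1 ha)) Finset.sdiff_subset
    rw [hUe, hEe] at h
    exact ⟨b', m', h.mono_target hSe⟩
  -- `v` is a deepest vertex, so no vertex of the same depth has children.
  have hdv := hd v hvr
  have hdeep : ∀ u ∈ U, u ≠ r → ∀ v', d v' = d v → par u ≠ v' := fun u hu hur v' hv' h => by
    have h1 := hd u hur
    have h2 := hmax u hu
    rw [h] at h1
    omega
  by_cases hsib : ∃ v' ∈ U, v' ≠ v ∧ v' ≠ r ∧ par v' = par v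
  · obtain ⟨v', hv'U, hv'v, hv'r, hpar⟩ := hsib
    have hdv' : d v' = d v := by rw [hd v' hv'r, hpar, hdv]
    exact key v v' hvU hv'U hv'v.symm hvr hv'r
      (fun u hu hur => by
        have huU := Finset.mem_of_mem_erase (Finset.mem_of_mem_erase hu)
        exact ⟨hdeep u huU hur v rfl, hdeep u huU hur v' hdv'⟩)
      (hdeep v hvU hvr v rfl) (hdeep v hvU hvr v' hdv') (Or.inl hpar)
  push Not at hsib
  by_cases hpr : par v = r
  · obtain ⟨b, m, hbm⟩ := exists_embedding_edge hc hvr hpr hpath hPS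
    refine ⟨b, m, ?_⟩
    have hUeq : U = {v, r} := by
      ext u
      simp only [Finset.mem_insert, Finset.mem_singleton]
      refine ⟨fun hu => ?_, by rintro (rfl | rfl) <;> assumption⟩
      by_contra hne
      push Not at hne
      refine hsib u hu hne.1 hne.2 ?_
      rw [hpr]
      refine hd0 _ ?_
      have h1 := hd u hne.2
      have h2 := hmax u hu
      rw [hpr, hr] at hdv
      omega
    have hEeq : U.erase r = {v} := by
      rw [hUeq, Finset.erase_insert_of_ne hvr]
      simp
    rw [hEeq]
    rwa [← hUeq] at hbm
  · have hpU := hU v hvU hvr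
    have hdp := hd (par v) hpr
    refine key (par v) v hpU hvU (fun h => by rw [h] at hdv; omega) hpr hvr ?_ ?_ ?_ (Or.inr rfl)
    · intro u hu hur
      have hu' := Finset.mem_erase.1 hu
      have huU := Finset.mem_of_mem_erase hu'.2
      exact ⟨hsib u huU hu'.1 hur, hdeep u huU hur v rfl⟩
    · intro h
      rw [h] at hdp
      omega
    · intro h
      rw [h] at hdp
      omega

/-! ### Cycles -/

/-- The cycle with vertices `0, …, n - 1` in which edge `i` joins `i` to its cyclic predecessor. -/
theorem exists_embedding_cycle [DecidableEq W] {c : W → W → Bool} (hc : ∀ x y, c x y = c y x)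
    {n : ℕ} (hn : 3 ≤ n) (S : Finset W) (hS : 2 * n ≤ S.card) :
    ∃ b m, IsCherryEmbedding c id (fun i => if i = 0 then n - 1 else i - 1) (Finset.range n)
      (Finset.range n) S b m := by
  by_cases hP : ∀ w x y z, w ∈ S → x ∈ S → y ∈ S → z ∈ S → ¬ IsAltPath c w x y z
  · refine exists_embedding_of_no_altPath hc ⟨0, by simp; omega⟩ ?_ ?_ (by simp; omega) hP
    · intro e he
      rw [Finset.mem_range] at he
      simp only [id, Finset.mem_range]
      split_ifs <;> omega
    · intro k hk hkn
      rw [Finset.card_range] at hkn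
      refine ⟨Finset.range k, by simpa using hkn, by simp, ?_⟩
      have : Finset.Ico 1 k ⊆ (Finset.range n).filter (fun e => id e ∈ Finset.range k ∧
          (if e = 0 then n - 1 else e - 1) ∈ Finset.range k) := by
        intro e he
        rw [Finset.mem_Ico] at he
        simp only [Finset.mem_filter, Finset.mem_range, id]
        split_ifs <;> omega
      have := Finset.card_le_card this
      rw [Nat.card_Ico] at this
      omega
  push Not at hP
  obtain ⟨w, x, y, z, hw, hx, hy, hz, hpath⟩ := hP
  have hfour : (S \ [w, x, y, z].toFinset).Nonempty := by
    have := Finset.le_card_sdiff [w, x, y, z].toFinset S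
    have h4 := List.toFinset_card_le [w, x, y, z]
    simp only [List.length_cons, List.length_nil] at h4
    exact Finset.card_pos.1 (by omega)
  -- A vertex `e` that is special only if all vertices off the path are.
  obtain ⟨e, he, hspec⟩ : ∃ e ∈ S \ [w, x, y, z].toFinset, ∀ u ∈ S \ [w, x, y, z].toFinset,
      IsSpecialVertex c w x y z e → IsSpecialVertex c w x y z u := by
    by_cases h : ∃ e ∈ S \ [w, x, y, z].toFinset, ¬ IsSpecialVertex c w x y z e
    · obtain ⟨e, he, hne⟩ := h
      exact ⟨e, he, fun _ _ h => absurd h hne⟩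
    · push Not at h
      obtain ⟨e, he⟩ := hfour
      exact ⟨e, he, fun u hu _ => h u hu⟩
  rw [Finset.mem_sdiff, List.mem_toFinset] at he
  set S' := S \ [e, w, x, y, z].toFinset with hS'
  have hS'c : S.card ≤ S'.card + 5 := by
    have := Finset.le_card_sdiff [e, w, x, y, z].toFinset S
    have h4 := List.toFinset_card_le [e, w, x, y, z]
    simp only [List.length_cons, List.length_nil] at h4
    rw [← hS'] at this
    omega
  have hout : ∀ a ∈ [e, w, x, y, z], a ∉ S' := fun a ha h =>
    (Finset.mem_sdiff.1 h).2 (List.mem_toFinset.2 ha)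
  obtain ⟨k, rfl⟩ : ∃ k, n = k + 3 := ⟨n - 3, by omega⟩
  obtain ⟨b, m, hbm⟩ := exists_embedding_rooted_tree hc (r := 0) (par := fun i => i - 1)
    (d := id) rfl (fun v hv => by simp only [id]; omega) (Finset.range (k + 1)) (by simp)
    (fun v hv _ => by simp only [Finset.mem_range] at *; omega) S'
    (by rw [Finset.card_range]; omega)
  set t : ℕ → ℕ := fun i => if i = 0 then k + 3 - 1 else i - 1 with ht
  have hbm' : IsCherryEmbedding c id t (Finset.range (k + 1)) ((Finset.range (k + 1)).erase 0)
      S' b m :=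
    ⟨hbm.branch_injOn, hbm.mid_injOn, hbm.branch_mem, hbm.mid_mem, hbm.mid_ne_branch,
      fun f hf => by
        have := hbm.mono f hf
        simpa only [t, if_neg (Finset.ne_of_mem_erase hf)] using this⟩
  have hbk : b k ∈ S \ [w, x, y, z].toFinset := by
    have := Finset.mem_sdiff.1 (hbm.branch_mem k (by simp))
    rw [List.mem_toFinset, List.mem_cons, not_or] at this
    rw [Finset.mem_sdiff, List.mem_toFinset]
    exact ⟨this.1, this.2.2⟩
  obtain ⟨x₁, y₁, x₂, y₂, x₃, hnd, hsub, hc₁, hc₂, hc₃⟩ :=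
    hpath.exists_closing hc (u := b k) (v := b 0) he.2 (hspec _ hbk)
  simp only [List.cons_subset, List.nil_subset, and_true] at hsub
  obtain ⟨hx₁, hy₁, hx₂, hy₂, hx₃⟩ := hsub
  simp only [List.nodup_cons, List.mem_cons, List.not_mem_nil, or_false, not_or] at hnd
  have ht1 : t (k + 1) = k := by simp [t]
  have ht2 : t (k + 2) = k + 1 := by simp [t]
  have ht0 : t 0 = k + 2 := by simp [t]
  have h1 := hbm'.insert_leaf (e := k + 1) (x := x₁) (y := y₁) ?_ (by simp) (by simp)
    (by simp [ht1]) (hout _ hx₁) (hout _ hy₁) hnd.1.1 (by rw [ht1, hc₁])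
  have h2 := h1.insert_leaf (e := k + 2) (x := x₂) (y := y₂) ?_ (by simp) (by simp)
    (by simp [ht2]) ?_ ?_ hnd.2.2.1.1 (by simp [ht2, hc₂])
  have h3 := h2.insert_mid (e := 0) (x := x₃) (by simp) ?_ (by simp [ht0, hc₃])
  · have hUe : insert (id (k + 2)) (insert (id (k + 1)) (Finset.range (k + 1))) =
        Finset.range (k + 3) := by
      ext u
      simp only [id, Finset.mem_insert, Finset.mem_range]
      omega
    have hEe : insert 0 (insert (k + 2) (insert (k + 1) ((Finset.range (k + 1)).erase 0))) =
        Finset.range (k + 3) := by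
      ext u
      simp only [Finset.mem_insert, Finset.mem_erase, Finset.mem_range]
      omega
    have h4 := h3.mono_target (S' := S) ?_
    · rw [hUe, hEe] at h4
      exact ⟨_, _, h4⟩
    · have hPS : ∀ a ∈ [e, w, x, y, z], a ∈ S := by simp [hw, hx, hy, hz, he.1]
      intro a ha
      simp only [Finset.mem_insert] at ha
      rcases ha with rfl | rfl | rfl | rfl | rfl | ha
      · exact hPS _ hx₃
      · exact hPS _ hx₂
      · exact hPS _ hy₂
      · exact hPS _ hx₁
      · exact hPS _ hy₁
      · exact (Finset.mem_sdiff.1 ha).1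
  · simp only [Finset.mem_insert, not_or]
    exact ⟨fun h => hnd.2.2.1.2 h.symm, fun h => hnd.2.2.2.1 h.symm, fun h => hnd.1.2.2.2 h.symm,
      fun h => hnd.2.1.2.2 h.symm, hout _ hx₃⟩
  · intro f hf
    simp only [id, Finset.mem_insert, Finset.mem_erase, Finset.mem_range, t] at hf ⊢
    split_ifs <;> omega
  · simp only [Finset.mem_insert, not_or]
    exact ⟨fun h => hnd.1.2.1 h.symm, fun h => hnd.2.1.1 h.symm, hout _ hx₂⟩
  · simp only [Finset.mem_insert, not_or]
    exact ⟨fun h => hnd.1.2.2.1 h.symm, fun h => hnd.2.1.2.1 h.symm, hout _ hy₂⟩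
  · intro f hf
    simp only [id, Finset.mem_erase, Finset.mem_range, t] at hf ⊢
    split_ifs <;> omega

/-! ### From embeddings to subdivisions -/

/-- The walk `x, y, z` in a complete graph. -/
def cherryWalk {x y z : W} (hxy : x ≠ y) (hyz : y ≠ z) : (⊤ : SimpleGraph W).Walk x z :=
  .cons ((SimpleGraph.top_adj _ _).2 hxy) (.cons ((SimpleGraph.top_adj _ _).2 hyz) .nil)

lemma length_cherryWalk {x y z : W} (hxy : x ≠ y) (hyz : y ≠ z) :
    (cherryWalk hxy hyz).length = 2 := rfl

lemma reverse_cherryWalk {x y y' z : W} (hxy : x ≠ y) (hyz : y ≠ z) (hzy : z ≠ y') (hyx : y' ≠ x)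
    (h : y' = y) : cherryWalk hzy hyx = (cherryWalk hxy hyz).reverse := by
  subst h
  rfl

lemma mem_support_cherryWalk {x y z a : W} (hxy : x ≠ y) (hyz : y ≠ z) :
    a ∈ (cherryWalk hxy hyz).support ↔ a = x ∨ a = y ∨ a = z := by
  simp [cherryWalk]

/-- If an embedding exists for every colouring, and `f` identifies `H` with a subgraph of the graph
given by `U` and `E`, then `H` is forced. -/
theorem forces_of_embedding {V₀ : Type*} {H : SimpleGraph V₀} {s t : ι → V} {U : Finset V}
    {E : Finset ι} {f : V₀ → V} (hf : Function.Injective f) (hfU : ∀ v, f v ∈ U)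
    (hfE : ∀ u v, H.Adj u v → ∃ e ∈ E, s(f u, f v) = s(s e, t e)) {N : ℕ}
    (hN : ∀ c : Fin N → Fin N → Bool, (∀ x y, c x y = c y x) →
      ∃ b m, IsCherryEmbedding c s t U E Finset.univ b m) : Forces 2 1 H N := by
  intro ω
  obtain ⟨b, m, hbm⟩ := hN (fun x y => decide (ω s(x, y) = 0))
    (fun x y => by rw [Sym2.eq_swap])
  have hedge : ∀ e : H.edgeSet, ∃ i ∈ E, (e : Sym2 V₀).map f = s(s i, t i) := by
    rintro ⟨e, he⟩
    induction e using Sym2.ind with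
    | _ u v => exact hfE u v he
  choose g hgE hg using hedge
  have hginj : ∀ e e', g e = g e' → e = e' := fun e e' h =>
    Subtype.ext (Sym2.map.injective hf (by rw [hg, hg, h]))
  have hne : ∀ e v, b (f v) ≠ m (g e) := fun e v => (hbm.mid_ne_branch _ (hgE e) _ (hfU v)).symm
  have hbinj : ∀ u v, b (f u) = b (f v) → u = v := fun u v h =>
    hf (hbm.branch_injOn (hfU u) (hfU v) h)
  refine ⟨⟨fun v => b (f v), fun u v h => hbinj u v h,
    fun {u v} h => cherryWalk (hne ⟨s(u, v), h⟩ u) (hne ⟨s(u, v), h⟩ v).symm,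
    fun {u v} h => ?_, fun {u v} h => ?_, fun {u v} h w hw => ?_,
    fun {u v u' v'} h h' hne' x hx hx' => ?_⟩,
    fun {u v} h => length_cherryWalk (hne ⟨s(u, v), h⟩ u) (hne ⟨s(u, v), h⟩ v).symm,
    fun {u v} h => ?_⟩
  · have : b (f u) ≠ b (f v) := fun h' => h.ne (hbinj u v h')
    simp [cherryWalk, SimpleGraph.Walk.isPath_def, hne, (hne _ _).symm, this]
  · exact reverse_cherryWalk _ _ _ _ (by simp only [Sym2.eq_swap])
  · rw [mem_support_cherryWalk] at hw
    rcases hw with hw | hw | hw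
    · exact Or.inl (hbinj _ _ hw)
    · exact absurd hw (hne _ _)
    · exact Or.inr (hbinj _ _ hw)
  · rw [mem_support_cherryWalk] at hx hx'
    rcases hx with rfl | rfl | rfl
    · exact ⟨u, rfl⟩
    · rcases hx' with hx' | hx' | hx'
      · exact absurd hx'.symm (hne _ _)
      · exact absurd (congrArg Subtype.val
          (hginj _ _ (hbm.mid_injOn (hgE _) (hgE _) hx'))) hne'
      · exact absurd hx'.symm (hne _ _)
    · exact ⟨v, rfl⟩
  · have hmono := hbm.mono _ (hgE ⟨s(u, v), h⟩)
    have huv := hg ⟨s(u, v), h⟩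
    simp only [Sym2.map_mk] at huv
    have key : (ω s(b (f u), m (g ⟨s(u, v), h⟩)) = 0 ↔ ω s(m (g ⟨s(u, v), h⟩), b (f v)) = 0) := by
      rw [Sym2.eq_swap]
      rcases Sym2.eq_iff.1 huv with ⟨h1, h2⟩ | ⟨h1, h2⟩
      · rw [h1, h2]
        simpa using hmono
      · rw [h1, h2]
        simpa using hmono.symm
    have hZ : ∀ p q : ZMod 2, (p = 0 ↔ q = 0) → p + q = 0 := by decide
    simpa [walkWeight, cherryWalk] using hZ _ _ key

/-! ### Vertex count -/

/-- The interior vertices of the subdivision paths are distinct and are not branch vertices. -/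
theorem card_add_card_edgeSet_le_of_forces {q : ℕ} {H : SimpleGraph V} [Fintype V]
    [Fintype H.edgeSet] {N : ℕ} (h : Forces q 1 H N) :
    Fintype.card V + Fintype.card H.edgeSet ≤ N := by
  obtain ⟨S, hS, -⟩ := h 0
  have hmid : ∀ e : H.edgeSet, ∃ x, x ∉ Set.range S.branch ∧
      ∃ u v, ∃ h : H.Adj u v, (e : Sym2 V) = s(u, v) ∧ x ∈ (S.path h).support := by
    rintro ⟨e, he⟩
    induction e using Sym2.ind with
    | _ u v =>
      have he' : H.Adj u v := he
      have hlen := hS he'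
      have hinj := (S.path_isPath he').getVert_injOn
      refine ⟨(S.path he').getVert 1, ?_, u, v, he', rfl, SimpleGraph.Walk.getVert_mem_support _ _⟩
      rintro ⟨w, hw⟩
      have h0 : (S.path he').getVert 0 = S.branch u := by simp
      have h2 : (S.path he').getVert 2 = S.branch v := by
        have := (S.path he').getVert_length
        rwa [hlen] at this
      rcases S.eq_or_eq_of_branch_mem he' w
        (hw ▸ SimpleGraph.Walk.getVert_mem_support _ _) with rfl | rfl
      · have := hinj (by simp) (by simp [hlen]) (h0.trans hw)
        omega
      · have := hinj (by simp [hlen]) (by simp [hlen]) (h2.trans hw)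
        omega
  choose x hx hpath using hmid
  have hxinj : Function.Injective x := fun e e' hee => by
    by_contra hne
    obtain ⟨u, v, h, he, hs⟩ := hpath e
    obtain ⟨u', v', h', he', hs'⟩ := hpath e'
    exact hx e (S.mem_range_branch_of_mem_of_mem h h'
      (fun h => hne (Subtype.ext (he.trans (h.trans he'.symm)))) _ hs (hee ▸ hs'))
  have hinj : Function.Injective (Sum.elim S.branch x) :=
    S.branch_injective.sumElim hxinj fun v e h => hx e ⟨v, h⟩
  simpa using Fintype.card_le_of_injective _ hinj

/-! ### Trees and cycles are forced -/

theorem forces_tree [Fintype V] {T : SimpleGraph V} (hT : T.IsTree) :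
    Forces 2 1 T (2 * Fintype.card V - 1) := by
  classical
  obtain ⟨r⟩ := hT.connected.nonempty
  have hpar : ∀ v, ∃ p, v ≠ r → T.Adj v p ∧ T.dist r v = T.dist r p + 1 := fun v => by
    by_cases hv : v = r
    · exact ⟨v, fun h => absurd hv h⟩
    obtain ⟨p, hp⟩ := hT.connected.exists_walk_length_eq_dist v r
    cases p with
    | nil => exact absurd rfl hv
    | cons hadj q =>
      refine ⟨_, fun _ => ⟨hadj, ?_⟩⟩
      have h1 := SimpleGraph.dist_le q
      rw [SimpleGraph.Walk.length_cons, SimpleGraph.dist_comm] at hp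
      rw [SimpleGraph.dist_comm] at h1
      rcases hT.dist_eq_dist_add_one_of_adj r hadj with h | h <;> omega
  choose par hpar using hpar
  refine forces_of_embedding (s := id) (t := par) (U := Finset.univ) (E := Finset.univ.erase r)
    Function.injective_id (fun v => Finset.mem_univ _) ?_ ?_
  · intro u v huv
    have hpc : ∀ p q : V, T.Adj p q → T.dist r p = T.dist r q + 1 →
        p ≠ r ∧ par p = q := by
      intro p q hpq hd
      have hp : p ≠ r := by rintro rfl; simp at hd
      refine ⟨hp, ?_⟩
      -- Both neighbours continue to geodesics from `p` to the root, which is unique.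
      have hpath : ∀ q, ∀ h : T.Adj p q, T.dist r p = T.dist r q + 1 →
          ∃ w : T.Walk q r, (SimpleGraph.Walk.cons h w).IsPath := fun q h hd => by
        obtain ⟨w, hw⟩ := hT.connected.exists_walk_length_eq_dist q r
        refine ⟨w, SimpleGraph.Walk.isPath_of_length_eq_dist _ ?_⟩
        rw [SimpleGraph.Walk.length_cons, hw, SimpleGraph.dist_comm, ← hd, SimpleGraph.dist_comm]
      obtain ⟨w, hw⟩ := hpath q hpq hd
      obtain ⟨w', hw'⟩ := hpath (par p) (hpar p hp).1 (hpar p hp).2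
      have := congrArg SimpleGraph.Walk.snd ((hT.existsUnique_path p r).unique hw' hw)
      simpa using this
    rcases hT.dist_eq_dist_add_one_of_adj r huv with h | h
    · obtain ⟨h1, h2⟩ := hpc u v huv h
      exact ⟨u, by simp [h1], by simp [h2]⟩
    · obtain ⟨h1, h2⟩ := hpc v u huv.symm h
      exact ⟨v, by simp [h1], by simp [h2, Sym2.eq_swap]⟩
  · intro c hc
    exact exists_embedding_rooted_tree hc (d := T.dist r) (by simp) (fun v hv => (hpar v hv).2) _
      (Finset.mem_univ _) (fun _ _ _ => Finset.mem_univ _) _ (by simp; omega)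

theorem forces_cycle {C : SimpleGraph V} {n : ℕ} (hn : 3 ≤ n)
    (φ : C ≃g SimpleGraph.cycleGraph n) : Forces 2 1 C (2 * n) := by
  refine forces_of_embedding (s := id) (t := fun i => if i = 0 then n - 1 else i - 1)
    (U := Finset.range n) (E := Finset.range n) (f := fun v => (φ v : ℕ))
    (fun u v h => φ.injective (Fin.ext h)) (fun v => by simp) (fun u v huv => ?_)
    (fun c hc => exists_embedding_cycle hc hn _ (by simp))
  rw [← φ.map_adj_iff, SimpleGraph.cycleGraph_adj'] at huv
  have key : ∀ x y : Fin n, (x - y).val = 1 →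
      (y : ℕ) = if (x : ℕ) = 0 then n - 1 else x - 1 := by
    intro x y h
    rw [Fin.sub_def] at h
    have hx := x.2
    have hy := y.2
    simp only at h
    split_ifs with h0
    · rw [h0, add_zero] at h
      rcases Nat.eq_zero_or_pos (y : ℕ) with h1 | h1
      · rw [h1, Nat.sub_zero, Nat.mod_self] at h
        omega
      · rw [Nat.mod_eq_of_lt (by omega)] at h
        omega
    · rcases Nat.lt_or_ge (n - y + x) n with h1 | h1
      · rw [Nat.mod_eq_of_lt h1] at h
        omega
      · rw [Nat.mod_eq_sub_mod h1, Nat.mod_eq_of_lt (by omega)] at h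
        omega
  rcases huv with h | h
  · exact ⟨φ u, by simp, by rw [key _ _ h]; rfl⟩
  · exact ⟨φ v, by simp, by rw [key _ _ h, Sym2.eq_swap]; rfl⟩

lemma card_edgeSet_cycle {C : SimpleGraph V} [Fintype C.edgeSet] {n : ℕ} (hn : 3 ≤ n)
    (φ : C ≃g SimpleGraph.cycleGraph n) : Fintype.card C.edgeSet = n := by
  obtain ⟨k, rfl⟩ : ∃ k, n = k + 3 := ⟨n - 3, by omega⟩
  have h := (SimpleGraph.cycleGraph (k + 3)).sum_degrees_eq_twice_card_edges
  simp only [SimpleGraph.cycleGraph_degree_three_le, Finset.sum_const, Finset.card_univ,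
    Fintype.card_fin, smul_eq_mul] at h
  rw [Fintype.card_congr φ.mapEdgeSet, ← SimpleGraph.edgeFinset_card]
  omega

end DivisibleSubdivision

theorem theorem1p8 :
    (∀ {V : Type*} [Fintype V] (T : SimpleGraph V) (n : ℕ),
      T.IsTree → Fintype.card V = n →
        DivisibleSubdivision.IsDivSubdivisionNumber 2 1 T (2 * n - 1)) ∧
    (∀ {V : Type*} (C : SimpleGraph V) (n : ℕ),
      3 ≤ n → Nonempty (C ≃g SimpleGraph.cycleGraph n) →
        DivisibleSubdivision.IsDivSubdivisionNumber 2 1 C (2 * n)) := by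
  classical
  refine ⟨?_, ?_⟩
  · rintro V _ T n hT rfl
    refine ⟨DivisibleSubdivision.forces_tree hT, fun N hN => ?_⟩
    have h1 := DivisibleSubdivision.card_add_card_edgeSet_le_of_forces hN
    have h2 := hT.card_edgeFinset
    rw [SimpleGraph.edgeFinset_card] at h2
    omega
  · rintro V C n hn ⟨φ⟩
    refine ⟨DivisibleSubdivision.forces_cycle hn φ, fun N hN => ?_⟩
    have := Fintype.ofEquiv _ φ.toEquiv.symm
    have h1 := DivisibleSubdivision.card_add_card_edgeSet_le_of_forces hN
    rw [DivisibleSubdivision.card_edgeSet_cycle hn φ, Fintype.card_congr φ.toEquiv,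
      Fintype.card_fin] at h1
    omega
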